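/- Let $\kappa$ be a cardinal. An $\Omega_\kappa$-system $\mathcal G$ consists of abelian groups $G_{\alpha,k}$ ($\alpha<\kappa$, $k\in\omega$) and homomorphisms $p_{\alpha,j,k}\colon G_{\alpha,j}\to G_{\alpha,k}$ for $j\ge k$, with $p_{\alpha,k,k}=\mathrm{id}$ and $p_{\alpha,k,l}\,p_{\alpha,j,k}=p_{\alpha,j,l}$. A morphism of $\Omega_\kappa$-systems is a family of homomorphisms $\varphi_{\alpha,k}\colon G_{\alpha,k}\to H_{\alpha,k}$ commuting with the structure maps. An $\Omega_\kappa$-system $\mathcal I$ is *injective* if for all morphisms $\varphi\colon\mathcal G\to\mathcal I$ and $\psi\colon\mathcal G\to\mathcal H$ such that every $\psi_{\alpha,k}$ is injective there is a morphism $\overline\varphi\colon\mathcal H\to\mathcal I$ with $\overline\varphi\psi=\varphi$. Order $\omega^\kappa$ pointwise, with pointwise minimum $\wedge$. For $x\in\omega^\kappa$ let $\overline G_x=\prod_{\alpha<\kappa}G_{\alpha,x(\alpha)}$ and let $G_x=\bigoplus_{\alpha<\kappa}G_{\alpha,x(\alpha)}$, regarded as the subgroup of finitely supported elements of $\overline G_x$;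 for $x\le y$ let $p_{y,x}=\prod_\alpha p_{\alpha,y(\alpha),x(\alpha)}$. This makes $\overline G$ and $G$ inverse systems indexed over $\omega^\kappa$. For $\mathbf G\in\{G,\overline G\}$, $X\subseteq\omega^\kappa$ and $n\ge 0$ let $$K^n(\mathbf G\upharpoonright X)=\Big\{y\in\prod_{(x_0,\dots,x_n)\in X^{n+1}}\mathbf G_{x_0\wedge\dots\wedge x_n}\ \Big|\ y(x_0,\dots,x_n)=\mathrm{sgn}(\sigma)\,y(x_{\sigma(0)},\dots,x_{\sigma(n)})\text{ for every permutation }\sigma\Big\}$$ (the meets need not lie in $X$), and let $d\colon K^n\to K^{n+1}$ be given by $$dy(x_0,\dots,x_{n+1})=\sum_{i=0}^{n+1}(-1)^i\,p_{\bigwedge_{j\ne i}x_j,\ \bigwedge_j x_j}\big(y(x_0,\dots,\widehat{x_i},\dots,x_{n+1})\big).$$ Write $K^n(\mathbf G)=K^n(\mathbf G\upharpoonright\omega^\kappa)$. For $a,b\in\overline G_x$ write $a=^*b$ if there is a finite $S\subseteq\kappa$ with $a(\alpha)=b(\alpha)$ for all $\alpha\in\kappa\setminus S$. Let $n\ge 1$.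 A family $\Phi\in K^{n-1}(\overline G\upharpoonright X)$ is *$n$-coherent* if $d\Phi\in K^n(G\upharpoonright X)$. An $n$-coherent family $\Phi$ is * *type I trivial* if either $n=1$ and there is $\psi=(\psi_x)_{x\in\omega^\kappa}\in\lim\overline G$ with $\Phi_f=^*\psi_f$ for all $f\in X$, or $n>1$ and there is $\Psi\in K^{n-2}(\overline G)$ with $\Phi_{\vec f}=^*(d\Psi)_{\vec f}$ for all $\vec f\in X^n$; * *type II trivial* if there is $\Psi\in K^{n-1}(G\upharpoonright X)$ with $d\Phi=d\Psi$. **Lemma.** Let $\mathcal I$ be an injective $\Omega_\kappa$-system. For every $X\subseteq\omega^\kappa$, every integer $n\ge1$ and every $n$-coherent $\Phi\in K^{n-1}(\overline I\upharpoonright X)$, $\Phi$ is type I trivial if and only if $\Phi$ is type II trivial. -/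

import Mathlib

universe u v

/-- An inverse system of abelian groups indexed over a preorder `P`: a group `obj x` for each `x`,
and compatible homomorphisms `obj y → obj x` for `x ≤ y`. -/
structure InvSystem (P : Type u) [Preorder P] where
  obj : P → Type v
  [grp : ∀ x, AddCommGroup (obj x)]
  map : ∀ {x y : P}, x ≤ y → obj y →+ obj x
  map_refl : ∀ (x : P) (a : obj x), map (le_refl x) a = a
  map_map : ∀ {x y z : P} (hxy : x ≤ y) (hyz : y ≤ z) (a : obj z),
    map hxy (map hyz a) = map (hxy.trans hyz) a

attribute [instance] InvSystem.grp

namespace InvSystem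

/-- A morphism of inverse systems: homomorphisms commuting with the structure maps. -/
structure Hom {P : Type u} [Preorder P] (A B : InvSystem P) where
  app : ∀ x, A.obj x →+ B.obj x
  naturality : ∀ {x y : P} (h : x ≤ y) (a : A.obj y), app x (A.map h a) = B.map h (app y a)

/-- The inverse limit: the group of compatible families `(ψ x)` indexed over all of `P`. -/
def lim {P : Type u} [Preorder P] (A : InvSystem P) : AddSubgroup (∀ x, A.obj x) where
  carrier := {ψ | ∀ (x y : P) (h : x ≤ y), A.map h (ψ y) = ψ x}
  zero_mem' := by intro x y h; simp
  add_mem' := by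
    intro a b ha hb x y h
    simp only [Pi.add_apply, map_add, ha x y h, hb x y h]
  neg_mem' := by
    intro a ha x y h
    simp only [Pi.neg_apply, map_neg, ha x y h]

end InvSystem

/-- The meet `x_0 ∧ ... ∧ x_n` of a nonempty finite tuple. -/
def tupleMeet {P : Type u} [SemilatticeInf P] {n : ℕ} (x : Fin (n + 1) → P) : P :=
  Finset.univ.inf' ⟨0, Finset.mem_univ 0⟩ x

theorem tupleMeet_le_comp {P : Type u} [SemilatticeInf P] {m n : ℕ} (x : Fin (n + 1) → P)
    (g : Fin (m + 1) → Fin (n + 1)) : tupleMeet x ≤ tupleMeet (fun i => x (g i)) :=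
  Finset.le_inf' _ _ fun i _ => Finset.inf'_le x (Finset.mem_univ (g i))

namespace InvSystem

/-- All families `y (x_0, ..., x_n) ∈ A_{x_0 ∧ ... ∧ x_n}` with `x_0, ..., x_n ∈ X`.
The meets are taken in `P` and need not belong to `X`. -/
abbrev Cochain {P : Type u} [SemilatticeInf P] (A : InvSystem P) (X : Set P) (n : ℕ) :=
  ∀ x : Fin (n + 1) → X, A.obj (tupleMeet fun i => (x i : P))

/-- The group `K^n(A ↾ X)` of alternating cochains: `y x = sgn σ • y (x ∘ σ)` for all `σ`.
(The meets of `x ∘ σ` and of `x` are equal; the structure map between the two groups is the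
identity, written out because the equality is not definitional.) -/
def K {P : Type u} [SemilatticeInf P] (A : InvSystem P) (X : Set P) (n : ℕ) :
    AddSubgroup (A.Cochain X n) where
  carrier := {y | ∀ (σ : Equiv.Perm (Fin (n + 1))) (x : Fin (n + 1) → X),
    y x = ((Equiv.Perm.sign σ : ℤˣ) : ℤ) •
      A.map (tupleMeet_le_comp (fun i => (x i : P)) σ) (y fun i => x (σ i))}
  zero_mem' := by intro σ x; simp
  add_mem' := by
    intro a b ha hb σ x
    simp only [Pi.add_apply, map_add, smul_add]
    rw [← ha σ x, ← hb σ x]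
  neg_mem' := by
    intro a ha σ x
    simp only [Pi.neg_apply, map_neg, smul_neg]
    rw [← ha σ x]

/-- The coboundary
`d y (x_0, ..., x_{n+1}) = ∑ i, (-1)^i p (y (x_0, ..., x_{i-1}, x_{i+1}, ..., x_{n+1}))`. -/
def d {P : Type u} [SemilatticeInf P] (A : InvSystem P) (X : Set P) (n : ℕ)
    (y : A.Cochain X n) : A.Cochain X (n + 1) :=
  fun x => ∑ i : Fin (n + 2), (-1 : ℤ) ^ (i : ℕ) •
    A.map (tupleMeet_le_comp (fun j => (x j : P)) i.succAbove) (y fun j => x (i.succAbove j))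

/-- The map on cochains induced by a morphism of inverse systems. -/
def Hom.onCochain {P : Type u} [SemilatticeInf P] {A B : InvSystem P} (φ : Hom A B) {X : Set P}
    {n : ℕ} (y : A.Cochain X n) : B.Cochain X n :=
  fun x => φ.app _ (y x)

end InvSystem

/-- An `Ω_κ`-system: for every index `α` in `κ` (any index set of the given cardinality), an
inverse system over `ω`. Its groups `G_{α,k}` are `(𝒢 α).obj k`, and the maps
`p_{α,j,k} : G_{α,j} → G_{α,k}`, `k ≤ j`, are `(𝒢 α).map`. -/
abbrev OmegaSystem (κ : Type u) : Type (max u (v + 1)) := κ → InvSystem.{0, v} ℕ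

namespace OmegaSystem

/-- A morphism of `Ω_κ`-systems. -/
abbrev Hom {κ : Type u} (𝒢 ℋ : OmegaSystem.{u, v} κ) := ∀ α, InvSystem.Hom (𝒢 α) (ℋ α)

/-- Injective `Ω_κ`-systems: every morphism `𝒢 → ℐ` extends along every morphism `𝒢 → ℋ`
all of whose components are injective. -/
def IsInjective {κ : Type u} (ℐ : OmegaSystem.{u, v} κ) : Prop :=
  ∀ (𝒢 ℋ : OmegaSystem.{u, v} κ) (φ : Hom 𝒢 ℐ) (ψ : Hom 𝒢 ℋ),
    (∀ α k, Function.Injective ((ψ α).app k)) →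
      ∃ φ' : Hom ℋ ℐ, ∀ α k a, (φ' α).app k ((ψ α).app k a) = (φ α).app k a

/-- The system `Ḡ` indexed over `ω^κ`, with `Ḡ_x = ∏ α, G_{α, x α}` and the product maps. -/
def prod {κ : Type u} (𝒢 : OmegaSystem.{u, v} κ) : InvSystem.{u, max u v} (κ → ℕ) where
  obj x := ∀ α, (𝒢 α).obj (x α)
  map {_ _} h :=
    { toFun := fun a α => (𝒢 α).map (h α) (a α)
      map_zero' := by funext α; simp
      map_add' := by intro a b; funext α; simp }
  map_refl x a := by funext α; exact (𝒢 α).map_refl _ _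
  map_map hxy hyz a := by funext α; exact (𝒢 α).map_map _ _ _

/-- The direct sum `G_x = ⨁ α, G_{α, x α}`, as the subgroup of finitely supported elements of the
product `Ḡ_x`. -/
def finSupp {κ : Type u} (𝒢 : OmegaSystem.{u, v} κ) (x : κ → ℕ) : AddSubgroup (𝒢.prod.obj x) where
  carrier := {a | {α | a α ≠ 0}.Finite}
  zero_mem' := by
    refine Set.Finite.subset Set.finite_empty fun α hα => hα ?_
    rfl
  add_mem' := by
    intro a b ha hb
    refine (Set.Finite.union ha hb).subset fun α hα => ?_
    by_contra hc
    have h1 : a α = 0 := by by_contra h; exact hc (Or.inl h)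
    have h2 : b α = 0 := by by_contra h; exact hc (Or.inr h)
    have h3 : (a + b) α = a α + b α := rfl
    exact hα (by rw [h3, h1, h2, add_zero])
  neg_mem' := by
    intro a ha
    refine Set.Finite.subset ha fun α hα h => hα ?_
    have h3 : (-a) α = -(a α) := rfl
    rw [h3, h, neg_zero]

theorem map_mem_finSupp {κ : Type u} (𝒢 : OmegaSystem.{u, v} κ) {x y : κ → ℕ} (h : x ≤ y)
    {a : 𝒢.prod.obj y} (ha : a ∈ 𝒢.finSupp y) : 𝒢.prod.map h a ∈ 𝒢.finSupp x := by
  refine Set.Finite.subset ha fun α hα h0 => hα ?_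
  change (𝒢 α).map (h α) (a α) = 0
  rw [h0, map_zero]

/-- The system `G` indexed over `ω^κ`, with `G_x = ⨁ α, G_{α, x α}`. -/
def sum {κ : Type u} (𝒢 : OmegaSystem.{u, v} κ) : InvSystem.{u, max u v} (κ → ℕ) where
  obj x := 𝒢.finSupp x
  map {x y} h := ((𝒢.prod.map h).comp (𝒢.finSupp y).subtype).codRestrict (𝒢.finSupp x)
    fun a => 𝒢.map_mem_finSupp h a.2
  map_refl x a := Subtype.ext (𝒢.prod.map_refl x a.1)
  map_map hxy hyz a := Subtype.ext (𝒢.prod.map_map hxy hyz a.1)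

/-- The inclusion of the system `G` into the system `Ḡ`. -/
def incl {κ : Type u} (𝒢 : OmegaSystem.{u, v} κ) : InvSystem.Hom 𝒢.sum 𝒢.prod where
  app x := (𝒢.finSupp x).subtype
  naturality _ _ := rfl

/-- `a =* b` in `Ḡ_x`: outside a finite set `S` of indices, `a` and `b` agree. -/
def AlmostEq {κ : Type u} {𝒢 : OmegaSystem.{u, v} κ} {x : κ → ℕ} (a b : 𝒢.prod.obj x) : Prop :=
  ∃ S : Finset κ, ∀ α, α ∉ S → a α = b α

/-- `Φ ∈ K^m(Ḡ ↾ X)` is `(m+1)`-coherent: `d Φ` belongs to `K^{m+1}(G ↾ X)`. -/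
def IsCoherent {κ : Type u} (𝒢 : OmegaSystem.{u, v} κ) (X : Set (κ → ℕ)) (m : ℕ)
    (Φ : 𝒢.prod.K X m) : Prop :=
  ∃ Θ ∈ 𝒢.sum.K X (m + 1), 𝒢.prod.d X m Φ.1 = 𝒢.incl.onCochain Θ

/-- Type I triviality of an `(m+1)`-coherent family `Φ ∈ K^m(Ḡ ↾ X)`. For `m + 1 = 1` there is
`ψ ∈ lim Ḡ` with `Φ_f =* p_f ψ` for all `f ∈ X`; for `m + 1 > 1` there is
`Ψ ∈ K^{m-1}(Ḡ)` with `Φ_f =* (d Ψ)_f` for all tuples `f` from `X`. The limit and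
`K^{m-1}(Ḡ)` are over all of `ω^κ`. -/
def IsTypeITrivial {κ : Type u} (𝒢 : OmegaSystem.{u, v} κ) (X : Set (κ → ℕ)) :
    (m : ℕ) → 𝒢.prod.K X m → Prop
  | 0, Φ => ∃ ψ ∈ 𝒢.prod.lim, ∀ f : Fin 1 → X,
      AlmostEq (Φ.1 f) (ψ (tupleMeet fun i => (f i : κ → ℕ)))
  | m + 1, Φ => ∃ Ψ ∈ 𝒢.prod.K Set.univ m, ∀ f : Fin (m + 2) → X,
      AlmostEq (Φ.1 f) (𝒢.prod.d Set.univ m Ψ fun i => ⟨(f i : κ → ℕ), Set.mem_univ _⟩)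

/-- Type II triviality of an `(m+1)`-coherent family `Φ ∈ K^m(Ḡ ↾ X)`: there is
`Ψ ∈ K^m(G ↾ X)` with `d Φ = d Ψ`. -/
def IsTypeIITrivial {κ : Type u} (𝒢 : OmegaSystem.{u, v} κ) (X : Set (κ → ℕ)) (m : ℕ)
    (Φ : 𝒢.prod.K X m) : Prop :=
  ∃ Ψ ∈ 𝒢.sum.K X m, 𝒢.prod.d X m Φ.1 = 𝒢.prod.d X m (𝒢.incl.onCochain Ψ)

end OmegaSystem

/-!
Both kinds of triviality say that `Φ` agrees, up to finitely supported values, with an alternating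
cocycle `y` of the system `Ḡ` over `X`. Indeed if `d Φ = d Ψ` with `Ψ` finitely supported, then
`y = Φ - Ψ` is such a cocycle, and if `y` is one, then `Ψ = Φ - y` has `d Ψ = d Φ`
(`IsTypeIITrivial.exists_almostEq`, `isTypeIITrivial_of_almostEq`). A type I trivialization is such
a `y` which moreover is the restriction to `X` of a coboundary (for one vertex, of a point of the
inverse limit) over all of `ω^κ`. So type I triviality implies type II triviality for every system,
and the converse amounts to: for an injective system, every alternating cocycle over `X` is the
restriction of a coboundary over `ω^κ` (`IsInjective.exists_ofFamily_eq`,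
`IsInjective.exists_restrict_d_eq`).

To see this, fix an index `α` and a level `i`. Pushing the `α`-coordinates of a cocycle `y` to
`I_{α,i}`, wherever this makes sense, gives a cocycle with constant coefficients on the full simplex
whose vertices are the `x ∈ X` with `i ≤ x α`. A full simplex is acyclic, by coning off at a vertex,
and the primitive so obtained can be extended by zero to all tuples from `ω^κ`
(`exists_primitive_at`). Injectivity of the system is used to put the levels together: the system
`I_α` is a retract of the system of finite products `∏ i ≤ k, I_{α,i}`, so there are homomorphisms
`∏ i, I_{α,i} → I_{α,k}`, compatible with the structure maps, that recover an element of `I_{α,k}`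
from its images at the levels `i ≤ k` (`IsInjective.exists_assembly`). Applied to the primitives at
all levels, they yield the `α`-coordinate of a primitive of `y`.

The identities `d ∘ d = 0` and the invariance of alternating cochains under `d` reduce to constant
coefficients in the same way: a cochain is determined by its localizations at all `w`, which are
obtained by pushing its values to the group at `w` (`InvSystem.localize`).
-/

/-! ### Cochains of a full simplex -/

section Simplex

variable {Y Z M : Type*} [AddCommGroup M]

/-- The coboundary of the full simplex on the vertex set `Y`, with constant coefficients `M` and
ordered simplices. The index `n` counts vertices, so the complex is the augmented one. -/
def simplexD {n : ℕ} (c : (Fin n → Y) → M) (x : Fin (n + 1) → Y) : M :=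
  ∑ i : Fin (n + 1), (-1 : ℤ) ^ (i : ℕ) • c (x ∘ i.succAbove)

/-- Alternating cochains. As in the definition of `InvSystem.K`, the condition is only about signs
of permutations: such a cochain may take a value of order two on a tuple with a repetition. -/
def IsAlternating {n : ℕ} (c : (Fin n → Y) → M) : Prop :=
  ∀ (σ : Equiv.Perm (Fin n)) (x : Fin n → Y),
    c x = ((Equiv.Perm.sign σ : ℤˣ) : ℤ) • c (x ∘ σ)

/-- Coning off at the vertex `b`. -/
def coneAt (b : Y) {n : ℕ} (c : (Fin (n + 1) → Y) → M) (x : Fin n → Y) : M :=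
  c (Fin.cons b x : Fin (n + 1) → Y)

theorem coneAt_simplexD (b : Y) {n : ℕ} (c : (Fin (n + 1) → Y) → M) :
    coneAt b (simplexD c) = c - simplexD (coneAt b c) := by
  funext x
  have h : ∀ i : Fin (n + 1), (Fin.cons b x : Fin (n + 2) → Y) ∘ i.succ.succAbove =
      Fin.cons b (x ∘ i.succAbove) := by
    intro i
    funext j
    refine Fin.cases ?_ (fun j => ?_) j <;> simp
  have h0 : (Fin.cons b x : Fin (n + 2) → Y) ∘ (0 : Fin (n + 2)).succAbove = x := by
    funext j
    simp
  simp only [coneAt, simplexD, Pi.sub_apply]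
  rw [Fin.sum_univ_succ, sub_eq_add_neg, ← Finset.sum_neg_distrib, h0]
  simp [h, pow_succ]

theorem simplexD_sub {n : ℕ} (c c' : (Fin n → Y) → M) :
    simplexD (c - c') = simplexD c - simplexD c' := by
  funext x
  simp [simplexD, smul_sub]

/-- Induction on the degree: coning off at the first vertex lowers it. -/
theorem simplexD_simplexD {n : ℕ} (c : (Fin n → Y) → M) : simplexD (simplexD c) = 0 := by
  induction n with
  | zero =>
    funext x
    simp [simplexD, Fin.sum_univ_succ, Subsingleton.elim (_ : Fin 0 → Y) Fin.elim0]
  | succ n ih =>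
    funext x
    have h : simplexD (simplexD c) x = coneAt (x 0) (simplexD (simplexD c)) (Fin.tail x) := by
      rw [coneAt, Fin.cons_self_tail]
    rw [h, coneAt_simplexD, coneAt_simplexD, simplexD_sub, ih]
    simp

theorem isAlternating_coneAt {n : ℕ} {c : (Fin (n + 1) → Y) → M} (hc : IsAlternating c) (b : Y) :
    IsAlternating (coneAt b c) := by
  intro σ x
  have h : (Fin.cons b x : Fin (n + 1) → Y) ∘ (Equiv.Perm.decomposeFin.symm (0, σ)) =
      Fin.cons b (x ∘ σ) := by
    funext j
    refine Fin.cases ?_ (fun j => ?_) j <;> simp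
  rw [coneAt, hc (Equiv.Perm.decomposeFin.symm (0, σ)), h]
  simp [coneAt]

/-- A permutation of the vertices of a simplex induces on the face opposite to the vertex `i` a
permutation whose sign is corrected by the positions of `i` and `σ i`. -/
theorem exists_perm_comp_succAbove {n : ℕ} (σ : Equiv.Perm (Fin (n + 1))) (i : Fin (n + 1)) :
    ∃ τ : Equiv.Perm (Fin n), (σ ∘ i.succAbove = (σ i).succAbove ∘ τ) ∧
      (Equiv.Perm.sign τ : ℤ) = (-1) ^ (i : ℕ) * (-1) ^ (σ i : ℕ) * (Equiv.Perm.sign σ : ℤ) := by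
  -- Composing with the cycles that move `i` and `σ i` to the front gives a permutation fixing `0`.
  set ρ : Equiv.Perm (Fin (n + 1)) := (σ i).cycleRange * σ * i.cycleRange⁻¹ with hρ
  have h0 : ρ 0 = 0 := by simp [hρ, Equiv.Perm.mul_apply]
  obtain ⟨⟨p, τ⟩, hτ⟩ := Equiv.Perm.decomposeFin.symm.surjective ρ
  have hp : p = 0 := by
    rw [← h0, ← hτ]; simp
  subst hp
  refine ⟨τ, ?_, ?_⟩
  · funext j
    have h1 : ρ j.succ = (τ j).succ := by rw [← hτ]; simp
    have h2 : ρ j.succ = (σ i).cycleRange (σ (i.succAbove j)) := by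
      simp [hρ, Equiv.Perm.mul_apply]
    have h3 := h1.symm.trans h2
    rw [← Fin.cycleRange_succAbove] at h3
    exact ((σ i).cycleRange.injective h3).symm
  · have h : Equiv.Perm.sign ρ = Equiv.Perm.sign τ := by rw [← hτ]; simp
    rw [← h, hρ]
    simp [Fin.sign_cycleRange]
    ring

theorem isAlternating_simplexD {n : ℕ} {c : (Fin n → Y) → M} (hc : IsAlternating c) :
    IsAlternating (simplexD c) := by
  intro σ x
  rw [simplexD, simplexD, Finset.smul_sum, ← Equiv.sum_comp σ]
  refine Finset.sum_congr rfl fun i _ => ?_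
  obtain ⟨τ, h, hs⟩ := exists_perm_comp_succAbove σ i
  have h1 : (x ∘ σ) ∘ i.succAbove = (x ∘ (σ i).succAbove) ∘ τ := by
    rw [Function.comp_assoc, h, Function.comp_assoc]
  rw [h1, hc τ, hs, smul_smul, smul_smul]
  congr 1
  have : ((-1 : ℤ) ^ (σ i : ℕ)) * (-1) ^ (σ i : ℕ) = 1 := by
    rw [← mul_pow]; simp
  linear_combination (-1 : ℤ) ^ (i : ℕ) * (Equiv.Perm.sign σ : ℤ) * this

/-- The full simplex is acyclic, and a primitive of a cocycle on it extends by zero to all tuples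
from a larger vertex set. -/
theorem exists_primitive_of_simplexD_eq_zero {S : Set Z} {n : ℕ} {c : (Fin (n + 1) → S) → M}
    (hc : IsAlternating c) (hd : simplexD c = 0) :
    ∃ b : (Fin n → Z) → M, IsAlternating b ∧
      ∀ x : Fin (n + 1) → S, simplexD b (fun i => (x i : Z)) = c x := by
  classical
  rcases S.eq_empty_or_nonempty with rfl | ⟨v, hv⟩
  · exact ⟨0, fun σ x => by simp, fun x => (x 0).2.elim⟩
  refine ⟨fun z => if h : ∀ j, z j ∈ S then coneAt ⟨v, hv⟩ c (fun j => ⟨z j, h j⟩) else 0,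
    fun σ z => ?_, fun x => ?_⟩
  · beta_reduce
    by_cases h : ∀ j, z j ∈ S
    · have h' : ∀ j, (z ∘ σ) j ∈ S := fun j => h (σ j)
      rw [dif_pos h, dif_pos h']
      exact isAlternating_coneAt hc _ σ _
    · have h' : ¬ ∀ j, (z ∘ σ) j ∈ S := fun h' => h fun j => by simpa using h' (σ.symm j)
      rw [dif_neg h, dif_neg h', smul_zero]
  · have key := congrFun (coneAt_simplexD ⟨v, hv⟩ c) x
    rw [hd, Pi.sub_apply, eq_comm, coneAt, Pi.zero_apply, sub_eq_zero] at key
    rw [key]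
    refine Finset.sum_congr rfl fun i _ => ?_
    have h : ∀ j, ((fun i => (x i : Z)) ∘ i.succAbove) j ∈ S := fun j => (x (i.succAbove j)).2
    beta_reduce
    rw [dif_pos h]
    rfl

end Simplex

/-! ### Localization of cochains on an inverse system -/

theorem le_tupleMeet {P : Type u} [SemilatticeInf P] {n : ℕ} {w : P} {x : Fin (n + 1) → P}
    (h : ∀ i, w ≤ x i) : w ≤ tupleMeet x :=
  Finset.le_inf' _ _ fun i _ => h i

theorem tupleMeet_le {P : Type u} [SemilatticeInf P] {n : ℕ} (x : Fin (n + 1) → P)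
    (i : Fin (n + 1)) : tupleMeet x ≤ x i :=
  Finset.inf'_le x (Finset.mem_univ i)

namespace InvSystem

section Localize

variable {P : Type u} [SemilatticeInf P] (A : InvSystem.{u, v} P) {X : Set P} {n : ℕ}

/-- The localization of a cochain at `w`: on tuples of elements of `X` above `w`, push all values to
the single group `A.obj w`. -/
def localize (w : P) (y : A.Cochain X n) (z : Fin (n + 1) → {x : X // w ≤ x}) : A.obj w :=
  A.map (le_tupleMeet fun i => (z i).2) (y fun i => (z i : X))

theorem localize_d (w : P) (y : A.Cochain X n) :
    A.localize w (A.d X n y) = simplexD (A.localize w y) := by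
  funext z
  simp only [localize, d, simplexD, map_sum, map_zsmul, A.map_map]
  rfl

/-- Every value of a cochain is a value of its localization at the meet of the tuple. -/
theorem apply_eq_localize (y : A.Cochain X n) (x : Fin (n + 1) → X) :
    y x = A.localize (tupleMeet fun i => (x i : P)) y
      (fun i => ⟨x i, tupleMeet_le _ i⟩) :=
  (A.map_refl _ _).symm

theorem cochain_ext {y y' : A.Cochain X n} (h : ∀ w, A.localize w y = A.localize w y') :
    y = y' := by
  funext x
  rw [A.apply_eq_localize y, h, ← A.apply_eq_localize]

theorem mem_K_iff_localize {y : A.Cochain X n} :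
    y ∈ A.K X n ↔ ∀ w, IsAlternating (A.localize w y) := by
  constructor
  · intro hy w σ z
    simp only [localize]
    rw [hy σ, map_zsmul, A.map_map]
    rfl
  · intro hy σ x
    rw [A.apply_eq_localize y, hy _ σ]
    rfl

theorem d_mem_K {y : A.Cochain X n} (hy : y ∈ A.K X n) : A.d X n y ∈ A.K X (n + 1) := by
  rw [mem_K_iff_localize] at hy ⊢
  intro w
  rw [localize_d]
  exact isAlternating_simplexD (hy w)

theorem d_sub (y y' : A.Cochain X n) : A.d X n (y - y') = A.d X n y - A.d X n y' := by
  funext x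
  simp [d, smul_sub]

theorem d_d (y : A.Cochain X n) : A.d X (n + 1) (A.d X n y) = 0 := by
  refine A.cochain_ext fun w => ?_
  rw [localize_d, localize_d, simplexD_simplexD]
  funext z
  exact (map_zero _).symm

/-- Restriction to `X` of a cochain defined on all of `P`. -/
def restrict (X : Set P) (y : A.Cochain Set.univ n) : A.Cochain X n :=
  fun x => y fun i => ⟨x i, Set.mem_univ _⟩

theorem restrict_mem_K {y : A.Cochain Set.univ n} (hy : y ∈ A.K Set.univ n) :
    A.restrict X y ∈ A.K X n :=
  fun σ _ => hy σ _

/-- The cochain on single elements given by a point of the inverse limit. -/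
def ofFamily (X : Set P) (ψ : ∀ x, A.obj x) : A.Cochain X 0 :=
  fun x => ψ (tupleMeet fun i => (x i : P))

theorem ofFamily_mem_K (ψ : ∀ x, A.obj x) : A.ofFamily X ψ ∈ A.K X 0 := by
  intro σ x
  obtain rfl : σ = 1 := Equiv.ext fun i => Fin.ext (by omega)
  rw [Equiv.Perm.sign_one, Units.val_one, one_smul]
  exact (A.map_refl _ _).symm

theorem d_ofFamily {ψ : ∀ x, A.obj x} (hψ : ψ ∈ A.lim) : A.d X 0 (A.ofFamily X ψ) = 0 := by
  funext x
  have h : ∀ {a b : P} (h : a ≤ b), A.map h (ψ b) = ψ a := fun h => hψ _ _ h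
  simp [d, ofFamily, h, Fin.sum_univ_succ]

theorem Hom.onCochain_mem_K {A B : InvSystem.{u, v} P} (φ : Hom A B) {y : A.Cochain X n}
    (hy : y ∈ A.K X n) : φ.onCochain y ∈ B.K X n := by
  intro σ x
  simp only [onCochain]
  rw [hy σ, map_zsmul, φ.naturality]

end Localize
end InvSystem

/-! ### Injective systems and extension of cocycles -/

namespace OmegaSystem
open InvSystem

section Assembly

/-- The system of finite products `∏ i ≤ k, I_i`, with the restrictions as structure maps. -/
def prodLE (I : InvSystem.{0, v} ℕ) : InvSystem.{0, v} ℕ where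
  obj k := ∀ i : {i // i ≤ k}, I.obj i
  map {_ _} h :=
    { toFun := fun a i => a ⟨i, i.2.trans h⟩
      map_zero' := rfl
      map_add' := fun _ _ => rfl }
  map_refl _ _ := rfl
  map_map _ _ _ := rfl

/-- The embedding of a system into the system of finite products of its groups. -/
def toProdLE (I : InvSystem.{0, v} ℕ) : InvSystem.Hom I (prodLE I) where
  app _ :=
    { toFun := fun a i => I.map i.2 a
      map_zero' := funext fun i => map_zero _
      map_add' := fun a b => funext fun i => map_add _ a b }
  naturality h a := by
    funext i
    exact I.map_map _ _ _

/-- What injectivity is used for. The embedding of `ℐ α` into the system of finite products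
`∏ i ≤ k, I_{α,i}` has a retraction. Composed with the restrictions of `∏ i, I_{α,i}`, it gives
homomorphisms `g k` from the full product that are compatible with the structure maps, and `g k`
recovers an element of `I_{α,k}` from its images in the groups `I_{α,i}`, `i ≤ k`. -/
theorem IsInjective.exists_assembly {κ : Type u} {ℐ : OmegaSystem.{u, v} κ} (hℐ : ℐ.IsInjective)
    (α : κ) : ∃ g : ∀ k, (∀ i, (ℐ α).obj i) →+ (ℐ α).obj k,
      (∀ {j k : ℕ} (h : j ≤ k) (a), (ℐ α).map h (g k a) = g j a) ∧
      ∀ (k : ℕ) (a : ∀ i, (ℐ α).obj i) (b : (ℐ α).obj k),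
        (∀ i (h : i ≤ k), a i = (ℐ α).map h b) → g k a = b := by
  obtain ⟨r, hr⟩ := hℐ ℐ (fun α => prodLE (ℐ α))
    (fun α => ⟨fun _ => AddMonoidHom.id _, fun _ _ => rfl⟩) (fun α => toProdLE (ℐ α)) (by
      intro α k a b hab
      have h : (ℐ α).map le_rfl a = (ℐ α).map le_rfl b := congrFun hab ⟨k, le_rfl⟩
      rwa [map_refl, map_refl] at h)
  refine ⟨fun k => ((r α).app k).comp
    { toFun := fun a (i : {i // i ≤ k}) => a i
      map_zero' := rfl
      map_add' := fun _ _ => rfl }, fun h a => ((r α).naturality h _).symm, fun k a b hab => ?_⟩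
  refine Eq.trans ?_ (hr α k b)
  refine congrArg ((r α).app k) ?_
  funext i
  exact hab i i.2

end Assembly

section Cocycle

variable {κ : Type u} {ℐ : OmegaSystem.{u, v} κ} {X : Set (κ → ℕ)} {m : ℕ}

/-- At the index `α` and the level `i`, a cocycle `y` becomes a cocycle with constant coefficients
`I_{α,i}` on the full simplex whose vertices are the `x ∈ X` with `i ≤ x α`, and hence has a
primitive, defined on all tuples from `ω^κ`. -/
theorem exists_primitive_at {y : ℐ.prod.Cochain X m} (hy : y ∈ ℐ.prod.K X m)
    (hd : ℐ.prod.d X m y = 0) (α : κ) (i : ℕ) :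
    ∃ c : (Fin m → κ → ℕ) → (ℐ α).obj i, IsAlternating c ∧
      ∀ (x : Fin (m + 1) → X) (h : i ≤ tupleMeet (fun j => (x j : κ → ℕ)) α),
        simplexD c (fun j => (x j : κ → ℕ)) = (ℐ α).map h (y x α) := by
  classical
  -- `w ≤ x` is the condition `i ≤ x α`.
  set w : κ → ℕ := Pi.single α i with hw
  have hwα : i ≤ w α := by simp [hw]
  have hwle : ∀ x : κ → ℕ, i ≤ x α → w ≤ x := by
    intro x hx β
    rcases eq_or_ne β α with rfl | hβ
    · simpa [hw] using hx
    · simp [hw, hβ]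
  let q : ℐ.prod.obj w →+ (ℐ α).obj i :=
    ((ℐ α).map hwα).comp (Pi.evalAddMonoidHom (fun β => (ℐ β).obj (w β)) α)
  let S : Set (κ → ℕ) := {x | x ∈ X ∧ w ≤ x}
  let e : S → {x : X // w ≤ x} := fun x => ⟨⟨x, x.2.1⟩, x.2.2⟩
  obtain ⟨c, hc, hcd⟩ := exists_primitive_of_simplexD_eq_zero (S := S)
    (c := fun z => q (ℐ.prod.localize w y (e ∘ z)))
    (by
      intro σ z
      beta_reduce
      rw [(ℐ.prod.mem_K_iff_localize.1 hy w) σ, map_zsmul]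
      rfl)
    (by
      funext z
      have h := congrFun (ℐ.prod.localize_d w y) (e ∘ z)
      rw [hd] at h
      have h' := (congrArg q h).symm
      rw [simplexD, map_sum] at h'
      simp only [map_zsmul] at h'
      refine h'.trans ((congrArg q (map_zero _)).trans (map_zero q)))
  refine ⟨c, hc, fun x h => ?_⟩
  have hx : ∀ j, w ≤ (x j : κ → ℕ) := fun j =>
    (hwle _ h).trans (tupleMeet_le _ j)
  refine (hcd fun j => ⟨x j, (x j).2, hx j⟩).trans ?_
  exact (ℐ α).map_map _ _ _

/-- The case of one vertex: a cocycle comes from a point of the inverse limit over `ω^κ`. -/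
theorem IsInjective.exists_ofFamily_eq (hℐ : ℐ.IsInjective) {y : ℐ.prod.Cochain X 0}
    (hy : y ∈ ℐ.prod.K X 0) (hd : ℐ.prod.d X 0 y = 0) :
    ∃ ψ ∈ ℐ.prod.lim, y = ℐ.prod.ofFamily X ψ := by
  choose g hg hg' using hℐ.exists_assembly
  choose c _ hc using exists_primitive_at hy hd
  refine ⟨fun x α => g α (x α) fun i => c α i Fin.elim0, fun x x' h => ?_, ?_⟩
  · funext α
    exact hg α _ _
  · funext x α
    refine (hg' α _ _ _ fun i h => ?_).symm
    rw [← hc α i x h]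
    simp [simplexD, Subsingleton.elim (_ : Fin 0 → κ → ℕ) Fin.elim0]

/-- The case of at least two vertices: a cocycle is the coboundary of a cochain defined on
`ω^κ`. -/
theorem IsInjective.exists_restrict_d_eq (hℐ : ℐ.IsInjective) {y : ℐ.prod.Cochain X (m + 1)}
    (hy : y ∈ ℐ.prod.K X (m + 1)) (hd : ℐ.prod.d X (m + 1) y = 0) :
    ∃ Ψ ∈ ℐ.prod.K Set.univ m, y = ℐ.prod.restrict X (ℐ.prod.d Set.univ m Ψ) := by
  choose g hg hg' using hℐ.exists_assembly
  choose c hc hcd using exists_primitive_at hy hd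
  refine ⟨fun x α => g α _ fun i => c α i fun j => (x j : κ → ℕ), fun σ x => ?_, ?_⟩
  · funext α
    refine Eq.trans ?_ (congrArg _ (hg α _ _).symm)
    refine Eq.trans ?_ (map_zsmul (g α _) _ _)
    refine congrArg _ ?_
    funext i
    exact hc α i σ _
  · funext x α
    have h : ∀ j : Fin (m + 2), (ℐ α).map (tupleMeet_le_comp (fun i => (x i : κ → ℕ)) j.succAbove α)
        (g α _ fun i => c α i ((fun i => (x i : κ → ℕ)) ∘ j.succAbove)) =
        g α _ fun i => c α i ((fun i => (x i : κ → ℕ)) ∘ j.succAbove) := fun j => hg α _ _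
    refine (hg' α _ (fun i => simplexD (c α i) fun j => (x j : κ → ℕ)) _
      fun i h => hcd α i x h).symm.trans ?_
    have e : (fun i => simplexD (c α i) fun j => (x j : κ → ℕ)) =
        ∑ j : Fin (m + 2), (-1 : ℤ) ^ (j : ℕ) •
          fun i => c α i ((fun i => (x i : κ → ℕ)) ∘ j.succAbove) := by
      funext i
      simp [simplexD]
    rw [e, map_sum]
    refine Eq.trans (Finset.sum_congr rfl fun j _ => ?_)
      (map_sum (Pi.evalAddMonoidHom (fun β => (ℐ β).obj _) α) _ _).symm
    rw [map_zsmul, ← h j]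
    rfl

end Cocycle

/-! ### The two notions of triviality -/

section Almost

variable {κ : Type u} {𝒢 : OmegaSystem.{u, v} κ} {X : Set (κ → ℕ)} {m : ℕ}

theorem almostEq_iff_sub_mem_finSupp {x : κ → ℕ} {a b : 𝒢.prod.obj x} :
    AlmostEq a b ↔ a - b ∈ 𝒢.finSupp x := by
  have hs : ∀ α, (a - b) α = a α - b α := fun _ => rfl
  constructor
  · rintro ⟨S, hS⟩
    refine S.finite_toSet.subset fun α hα => ?_
    by_contra h
    exact hα (by rw [hs, hS α h, sub_self])
  · intro h
    have h : {α | (a - b) α ≠ 0}.Finite := h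
    refine ⟨h.toFinset, fun α hα => ?_⟩
    by_contra hne
    exact hα (h.mem_toFinset.2 fun h0 => hne (sub_eq_zero.1 ((hs α).symm.trans h0)))

/-- An alternating cochain with finitely supported values lifts to `K^m(G ↾ X)`. -/
theorem exists_onCochain_incl_eq {y : 𝒢.prod.Cochain X m} (hy : y ∈ 𝒢.prod.K X m)
    (hf : ∀ x, y x ∈ 𝒢.finSupp _) : ∃ Ψ ∈ 𝒢.sum.K X m, 𝒢.incl.onCochain Ψ = y :=
  ⟨fun x => ⟨y x, hf x⟩, fun σ x => Subtype.ext (hy σ x), rfl⟩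

theorem onCochain_incl_mem_finSupp (Ψ : 𝒢.sum.Cochain X m) (x : Fin (m + 1) → X) :
    𝒢.incl.onCochain Ψ x ∈ 𝒢.finSupp _ :=
  (Ψ x).2

/-- An alternating cocycle that almost agrees with `Φ` witnesses type II triviality: the difference
is a finitely supported family with the same coboundary. -/
theorem isTypeIITrivial_of_almostEq {Φ : 𝒢.prod.K X m} {y : 𝒢.prod.Cochain X m}
    (hy : y ∈ 𝒢.prod.K X m) (hd : 𝒢.prod.d X m y = 0) (h : ∀ x, AlmostEq (Φ.1 x) (y x)) :
    𝒢.IsTypeIITrivial X m Φ := by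
  obtain ⟨Ψ, hΨ, he⟩ := exists_onCochain_incl_eq ((𝒢.prod.K X m).sub_mem Φ.2 hy)
    fun x => almostEq_iff_sub_mem_finSupp.1 (h x)
  exact ⟨Ψ, hΨ, by rw [he, d_sub, hd, sub_zero]⟩

/-- Conversely, type II triviality provides such a cocycle. -/
theorem IsTypeIITrivial.exists_almostEq {Φ : 𝒢.prod.K X m} (h : 𝒢.IsTypeIITrivial X m Φ) :
    ∃ y ∈ 𝒢.prod.K X m, 𝒢.prod.d X m y = 0 ∧ ∀ x, AlmostEq (Φ.1 x) (y x) := by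
  obtain ⟨Ψ, hΨ, he⟩ := h
  refine ⟨Φ.1 - 𝒢.incl.onCochain Ψ, (𝒢.prod.K X m).sub_mem Φ.2 (𝒢.incl.onCochain_mem_K hΨ),
    by rw [d_sub, he, sub_self], fun x => almostEq_iff_sub_mem_finSupp.2 ?_⟩
  rw [Pi.sub_apply, sub_sub_cancel]
  exact onCochain_incl_mem_finSupp Ψ x

end Almost
end OmegaSystem

theorem mainTheorem8 {κ : Type u} (ℐ : OmegaSystem.{u, v} κ) (hℐ : ℐ.IsInjective)
    (X : Set (κ → ℕ)) (m : ℕ) (Φ : ℐ.prod.K X m) (hΦ : ℐ.IsCoherent X m Φ) :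
    ℐ.IsTypeITrivial X m Φ ↔ ℐ.IsTypeIITrivial X m Φ := by
  cases m with
  | zero =>
    constructor
    · rintro ⟨ψ, hψ, h⟩
      exact OmegaSystem.isTypeIITrivial_of_almostEq (ℐ.prod.ofFamily_mem_K ψ) (ℐ.prod.d_ofFamily hψ) h
    · intro h
      obtain ⟨y, hy, hd, hΦy⟩ := h.exists_almostEq
      obtain ⟨ψ, hψ, rfl⟩ := hℐ.exists_ofFamily_eq hy hd
      exact ⟨ψ, hψ, hΦy⟩
  | succ m =>
    constructor
    · rintro ⟨Ψ, hΨ, h⟩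
      exact OmegaSystem.isTypeIITrivial_of_almostEq (ℐ.prod.restrict_mem_K (ℐ.prod.d_mem_K hΨ))
        (ℐ.prod.d_d (ℐ.prod.restrict X Ψ)) h
    · intro h
      obtain ⟨y, hy, hd, hΦy⟩ := h.exists_almostEq
      obtain ⟨Ψ, hΨ, rfl⟩ := hℐ.exists_restrict_d_eq hy hd
      exact ⟨Ψ, hΨ, hΦy⟩
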